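/- **Setting.** Let $N\ge 1$, $\mathcal P=\{1,\dots,N\}$, $n,m\in\mathbb N$, and let $f_i,g_{i,1},\dots,g_{i,m}$ ($i\in\mathcal P$) be twice continuously differentiable vector fields on $\mathbb R^n$ with $f_i(0)=0$, $g_{i,j}(0)=0$. Let $\sigma=(\sigma(t))_{t\ge0}$ be a càdlàg $\mathcal P$-valued process on a probability space $(\Omega,\mathfrak F,\mathsf P)$ with deterministic $\sigma(0)=\sigma_0$, and consider $$\dot x=f_{\sigma}(x)+\sum_{j=1}^m g_{\sigma,j}(x)\,u_j,\qquad x(0)=x_0,\quad u\in\mathbb R^m .$$ The signal $\sigma$ is of class EH with parameters $\lambda>0$ and $q_i\in[0,1]$ ($i\in\mathcal P$) if there are random switching instants $0=\tau_0<\tau_1<\tau_2<\cdots$ such that $\sigma$ is constant on each $[\tau_k,\tau_{k+1})$ (the mode selected at a switching instant may equal the previous one) and (EH1) the holding times $S_k=\tau_k-\tau_{k-1}$, $k\ge1$, are i.i.d. exponential with parameter $\lambda$; (EH2) $\mathsf P\bigl(\sigma(\tau_j)=i\mid\sigma(\tau_0),\dots,\sigma(\tau_{j-1})\bigr)=q_i$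 almost surely for all $j\ge1$, $i\in\mathcal P$; (EH3) the sequences $(S_k)_{k\ge1}$ and $(\sigma(\tau_k))_{k\ge0}$ are independent. **Theorem.** Let $\sigma$ be of class EH with parameters $\lambda$, $(q_i)$. Let $V_i:\mathbb R^n\to\mathbb R$ ($i\in\mathcal P$) be twice continuously differentiable, $\alpha_1,\alpha_2$ functions of class $\mathcal K_\infty$ (continuous strictly increasing unbounded functions $[0,\infty)\to[0,\infty)$ vanishing at $0$) and $\mu>1$, such that for all $x\in\mathbb R^n$, $i,j\in\mathcal P$, (V1) $\alpha_1(\|x\|)\le V_i(x)\le\alpha_2(\|x\|)$, and (V3) $V_i(x)\le\mu V_j(x)$. Let $\bar k:\mathbb R^n\to\mathbb R^m$ be a mode-independent feedback for which the closed-loop vector fields $F_i:=f_i+\sum_{j=1}^m \bar k_j\,g_{i,j}$ are locally Lipschitz, and let $\lambda_i\in\mathbb R$ (of any sign, so some closed-loop subsystems may be unstable) satisfy $$\langle\nabla V_i(x),F_i(x)\rangle\le-\lambda_iV_i(x)\qquad\text{for all }x\in\mathbb R^n,\ i\in\mathcal P .$$ Assume (E3) $\lambda_i+\lambda>0$ for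 all $i\in\mathcal P$, and (E4) $\displaystyle\sum_{i\in\mathcal P}\frac{\mu q_i}{1+\lambda_i/\lambda}<1$. Then, almost surely, for every $x_0\in\mathbb R^n$ the closed-loop switched system $\dot x=F_\sigma(x)$, $x(0)=x_0$, has exactly one (Carathéodory) solution $x(\cdot)$ on $[0,\infty)$, and the closed-loop system is globally asymptotically stable almost surely: (AS1) almost surely, for every $\varepsilon>0$ there is $\delta>0$ such that $\|x_0\|<\delta$ implies $\sup_{t\ge0}\|x(t)\|<\varepsilon$; (AS2) almost surely, for all $r,\varepsilon'>0$ there is $T\ge0$ such that $\|x_0\|<r$ implies $\sup_{t\ge T}\|x(t)\|<\varepsilon'$. ($\delta$ and $T$ may depend on the sample point, but not on $x_0$.) -/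

import Mathlib

open MeasureTheory ProbabilityTheory Filter Topology
open scoped ENNReal NNReal

namespace RandSwitch

/-- The state space `ℝⁿ` with the Euclidean norm. -/
abbrev Space (n : ℕ) : Type := EuclideanSpace ℝ (Fin n)

/-- Comparison functions of class `K∞`. -/
structure ClassKInfty (α : ℝ≥0 → ℝ≥0) : Prop where
  continuous : Continuous α
  map_zero : α 0 = 0
  strictMono : StrictMono α
  unbounded : Tendsto α atTop atTop

/-- The Lie derivative `⟨∇V(x), f(x)⟩` of `V` along the vector field `f`. -/
noncomputable def lieDeriv {n : ℕ} (f : Space n → Space n) (V : Space n → ℝ) (x : Space n) : ℝ :=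
  inner ℝ (gradient V x) (f x)

/-- The vector field `x ↦ f(x) + ∑ⱼ kⱼ(x) gⱼ(x)` obtained from the control-affine system
`ẋ = f(x) + ∑ⱼ uⱼ gⱼ(x)` with the feedback `u = k(x)`. -/
noncomputable def closedLoop {n m : ℕ} (f : Space n → Space n) (g : Fin m → Space n → Space n)
    (k : Space n → EuclideanSpace ℝ (Fin m)) : Space n → Space n :=
  fun x => f x + ∑ j, k x j • g j x

/-- A switching signal: a process `(σ(t))_{t ≥ 0}` with values in the set of `N` modes, with
càdlàg paths and a known initial mode `σ₀`. (The values `σ t` with `t < 0` play no role.) -/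
structure IsSwitchingSignal {Ω : Type*} [MeasurableSpace Ω] {N : ℕ}
    (σ : ℝ → Ω → Fin N) (σ₀ : Fin N) : Prop where
  measurable : ∀ t, 0 ≤ t → Measurable (σ t)
  right_continuous : ∀ ω t, 0 ≤ t → ContinuousWithinAt (fun s => σ s ω) (Set.Ici t) t
  left_limit : ∀ ω t, 0 < t → ∃ i, Tendsto (fun s => σ s ω) (𝓝[<] t) (𝓝 i)
  initial : ∀ ω, σ 0 ω = σ₀

/-- `τ₀ = 0 < τ₁ < τ₂ < ⋯` are the (random) switching instants of `σ`: the mode is constant on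
each `[τ_k, τ_{k+1})`. At a switching instant a new mode is selected; it may coincide
with the old one. -/
structure IsSwitchingInstants {Ω : Type*} [MeasurableSpace Ω] {N : ℕ}
    (σ : ℝ → Ω → Fin N) (τ : ℕ → Ω → ℝ) : Prop where
  measurable : ∀ k, Measurable (τ k)
  zero : ∀ ω, τ 0 ω = 0
  strictMono : ∀ ω, StrictMono (fun k => τ k ω)
  const : ∀ ω k t, τ k ω ≤ t → t < τ (k + 1) ω → σ t ω = σ (τ k ω) ω

/-- `holding τ k` is the holding time `τ_{k+1} - τ_k`. -/
def holding {Ω : Type*} (τ : ℕ → Ω → ℝ) (k : ℕ) (ω : Ω) : ℝ := τ (k + 1) ω - τ k ω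

/-- `dest σ τ k` is the mode `σ(τ_k)`. -/
def dest {Ω : Type*} {N : ℕ} (σ : ℝ → Ω → Fin N) (τ : ℕ → Ω → ℝ) (k : ℕ) (ω : Ω) : Fin N :=
  σ (τ k ω) ω

/-- The switching signal `σ` with switching instants `τ` is of class EH, with rate `rate` of the
exponential holding times and mode probabilities `q`. -/
structure ClassEH {Ω : Type*} [MeasurableSpace Ω] (P : Measure Ω) {N : ℕ}
    (σ : ℝ → Ω → Fin N) (τ : ℕ → Ω → ℝ) (rate : ℝ) (q : Fin N → ℝ) : Prop where
  instants : IsSwitchingInstants σ τ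
  rate_pos : 0 < rate
  holding_indep : iIndepFun (holding τ) P
  holding_law : ∀ k, HasLaw (holding τ k) (expMeasure rate) P
  q_mem : ∀ i, q i ∈ Set.Icc (0 : ℝ) 1
  dest_law : ∀ i, ∀ j, 1 ≤ j →
    P⟦{ω | dest σ τ j ω = i} | ⨆ k : Fin j, MeasurableSpace.comap (dest σ τ k) ⊤⟧
      =ᵐ[P] fun _ => q i
  indep : IndepFun (fun ω k => holding τ k ω) (fun ω k => dest σ τ k ω) P

/-- `x` is a (Carathéodory) solution on `[0, ∞)` of `ẋ = F_{s(t)}(x)`, `x(0) = x₀`, for the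
mode path `s`; the values `x t` with `t < 0` play no role. -/
structure IsSolution {n N : ℕ} (F : Fin N → Space n → Space n) (s : ℝ → Fin N) (x₀ : Space n)
    (x : ℝ → Space n) : Prop where
  continuousOn : ContinuousOn x (Set.Ici 0)
  integrable : ∀ t, 0 ≤ t → IntervalIntegrable (fun u => F (s u) (x u)) volume 0 t
  eq_integral : ∀ t, 0 ≤ t → x t = x₀ + ∫ u in (0 : ℝ)..t, F (s u) (x u)

/-- Almost surely, for every initial state the switched system `ẋ = F_σ(x)` has one and only one
solution on `[0, ∞)`. -/
def WellPosed {Ω : Type*} [MeasurableSpace Ω] (P : Measure Ω) {n N : ℕ}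
    (F : Fin N → Space n → Space n) (σ : ℝ → Ω → Fin N) : Prop :=
  ∀ᵐ ω ∂P, ∀ x₀, ∃ x, IsSolution F (fun t => σ t ω) x₀ x ∧
    ∀ y, IsSolution F (fun t => σ t ω) x₀ y → Set.EqOn y x (Set.Ici 0)

/-- Global asymptotic stability almost surely of the switched system `ẋ = F_σ(x)`. The suprema
are taken in `[0, ∞]`. -/
structure GASAlmostSurely {Ω : Type*} [MeasurableSpace Ω] (P : Measure Ω) {n N : ℕ}
    (F : Fin N → Space n → Space n) (σ : ℝ → Ω → Fin N) : Prop where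
  stable : ∀ᵐ ω ∂P, ∀ ε : ℝ, 0 < ε → ∃ δ : ℝ, 0 < δ ∧ ∀ x₀ x,
    IsSolution F (fun t => σ t ω) x₀ x → ‖x₀‖ < δ →
      ⨆ t ∈ Set.Ici (0 : ℝ), ‖x t‖ₑ < ENNReal.ofReal ε
  attractive : ∀ᵐ ω ∂P, ∀ r ε : ℝ, 0 < r → 0 < ε → ∃ T : ℝ, 0 ≤ T ∧ ∀ x₀ x,
    IsSolution F (fun t => σ t ω) x₀ x → ‖x₀‖ < r →
      ⨆ t ∈ Set.Ici T, ‖x t‖ₑ < ENNReal.ofReal ε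

end RandSwitch

/-! While mode i is active, `V i` is multiplied by at most `exp (-lam i * S)` over a holding time
`S`, and each selection of a new mode costs at most a factor `μ`. Hence the Lyapunov value at the
k-th switching instant is at most a random product `growth`, independent of the initial state, times
its initial value. Bounded products give stability, products tending to zero give attractivity, and
both are uniform in the initial state.

The mean of the product is explicit. An exponential holding time in mode i contributes `μ / (1 + lam
i / rate)`, finite by (E3). By (EH2) and (EH3) the modes after the first act as independent draws
from `q`, independent of the holding times. So k + 1 factors have mean equal to a constant times
ρ^k, where ρ < 1 is the sum in (E4) (`ClassEH.lintegral_prod`). These means are summable, so almost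
surely the products form a convergent series and tend to zero (`ClassEH.ae_tendsto_prod`).

For well-posedness, properness of `V i` excludes finite escape within a mode
(`exists_solution_of_lieDeriv_le`), and the same product argument excludes accumulation of switching
instants (`ClassEH.ae_tendsto_instants`). -/

namespace RandSwitch

/-! ### Lyapunov estimates, existence and uniqueness for right-differentiable curves -/

section Flow

variable {n : ℕ}

/-- Comparison estimate along a curve with right derivative `G`. -/
lemma le_exp_mul_of_lieDeriv_le {V : Space n → ℝ} (hV : Differentiable ℝ V) {x G : ℝ → Space n}
    {a b c : ℝ} (hx : ContinuousOn x (Set.Icc a b))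
    (hx' : ∀ t ∈ Set.Ico a b, HasDerivWithinAt x (G t) (Set.Ici t) t)
    (hc : ∀ t ∈ Set.Ico a b, inner ℝ (gradient V (x t)) (G t) ≤ c * V (x t)) :
    ∀ t ∈ Set.Icc a b, V (x t) ≤ Real.exp (c * (t - a)) * V (x a) := by
  have hE : ∀ t, HasDerivAt (fun t => Real.exp (-(c * (t - a))))
      (Real.exp (-(c * (t - a))) * -c) t := fun t => by
    have := (((hasDerivAt_id t).sub_const a).const_mul c).neg.exp
    simpa using this
  -- `V (x t) * exp (-c (t - a))` has nonpositive right derivative, so the constant `V (x a)` is a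
  -- barrier for it.
  have key := image_le_of_deriv_right_le_deriv_boundary
    (f := fun t => V (x t) * Real.exp (-(c * (t - a))))
    (f' := fun t => inner ℝ (gradient V (x t)) (G t) * Real.exp (-(c * (t - a))) +
      V (x t) * (Real.exp (-(c * (t - a))) * -c)) (a := a) (b := b)
    (B := fun _ => V (x a)) (B' := fun _ => 0)
    ((hV.continuous.comp_continuousOn hx).mul (by fun_prop))
    (fun t ht => by
      refine HasDerivWithinAt.mul ?_ (hE t).hasDerivWithinAt
      have h1 := (hV (x t)).hasGradientAt.hasFDerivAt.comp_hasDerivWithinAt t (hx' t ht)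
      refine h1.congr_deriv ?_
      simp)
    (by simp) continuousOn_const (fun t _ => hasDerivWithinAt_const _ _ _)
    (fun t ht => by
      have h1 := hc t ht
      have h2 := Real.exp_pos (-(c * (t - a)))
      nlinarith)
  intro t ht
  have h1 : V (x t) * Real.exp (-(c * (t - a))) ≤ V (x a) := key ht
  rw [Real.exp_neg, ← div_eq_mul_inv, div_le_iff₀ (Real.exp_pos _)] at h1
  linarith

/-- A real cutoff equal to `1` on the ball of radius `R` and `0` off the ball of radius `R + 1`. -/
noncomputable def cutoff (R : ℝ) (x : Space n) : ℝ := max 0 (min 1 (R + 1 - ‖x‖))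

lemma cutoff_nonneg (R : ℝ) (x : Space n) : 0 ≤ cutoff R x := le_max_left _ _

lemma cutoff_le_one (R : ℝ) (x : Space n) : cutoff R x ≤ 1 :=
  max_le zero_le_one (min_le_left _ _)

lemma cutoff_eq_one {R : ℝ} {x : Space n} (hx : ‖x‖ ≤ R) : cutoff R x = 1 := by
  rw [cutoff, min_eq_left (by linarith), max_eq_right zero_le_one]

lemma cutoff_eq_zero {R : ℝ} {x : Space n} (hx : R + 1 ≤ ‖x‖) : cutoff R x = 0 :=
  max_eq_left ((min_le_right _ _).trans (by linarith))

lemma locallyLipschitz_cutoff (R : ℝ) : LocallyLipschitz (cutoff R : Space n → ℝ) := by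
  have h : LocallyLipschitz fun x : Space n => R + 1 - ‖x‖ :=
    (LocallyLipschitz.const (R + 1)).sub lipschitzWith_one_norm.locallyLipschitz
  exact (h.const_min 1).const_max 0

lemma locallyLipschitz_smul : LocallyLipschitz fun p : ℝ × Space n => p.1 • p.2 := by
  have h : ContDiff ℝ 1 fun p : ℝ × Space n => p.1 • p.2 := by fun_prop
  exact h.locallyLipschitz

lemma locallyLipschitz_cutoff_smul {F : Space n → Space n} (hF : LocallyLipschitz F) (R : ℝ) :
    LocallyLipschitz fun x => cutoff R x • F x :=
  LocallyLipschitz.comp (g := fun x => (cutoff R x, F x)) locallyLipschitz_smul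
    ((locallyLipschitz_cutoff R).prodMk hF)

lemma exists_lipschitzOnWith_closedBall {F : Space n → Space n}
    (hF : LocallyLipschitz F) (z : Space n) (r : ℝ) :
    ∃ K, LipschitzOnWith K F (Metric.closedBall z r) :=
  (hF.locallyLipschitzOn).exists_lipschitzOnWith_of_compact (isCompact_closedBall z r)

lemma exists_norm_cutoff_smul_le {F : Space n → Space n} (hF : Continuous F) (R : ℝ) :
    ∃ L : ℝ≥0, ∀ x, ‖cutoff R x • F x‖ ≤ L := by
  obtain ⟨C, hC⟩ := (isCompact_closedBall (0 : Space n) (R + 1)).exists_bound_of_continuousOn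
    hF.continuousOn
  refine ⟨C.toNNReal, fun x => ?_⟩
  rw [Real.coe_toNNReal']
  rcases le_total (R + 1) ‖x‖ with h | h
  · simp [cutoff_eq_zero h]
  · refine le_trans ?_ (le_max_left _ _)
    rw [norm_smul, Real.norm_of_nonneg (cutoff_nonneg R x)]
    calc cutoff R x * ‖F x‖ ≤ 1 * ‖F x‖ := by gcongr; exact cutoff_le_one R x
      _ ≤ C := by rw [one_mul]; exact hC x (by simpa using h)

/-- `x` solves `ẋ = F_{s(t)}(x)` on `[a, b]` in the sense of right derivatives. -/
structure IsRightSolution {N : ℕ} (F : Fin N → Space n → Space n) (s : ℝ → Fin N) (a b : ℝ)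
    (x : ℝ → Space n) : Prop where
  continuousOn : ContinuousOn x (Set.Icc a b)
  hasDeriv : ∀ t ∈ Set.Ico a b, HasDerivWithinAt x (F (s t) (x t)) (Set.Ici t) t

/-- A locally Lipschitz vector field with a proper nonnegative function that grows at most
exponentially along it has solutions on every compact interval. -/
lemma exists_solution_of_lieDeriv_le {F : Space n → Space n} (hF : LocallyLipschitz F)
    {V : Space n → ℝ} (hV : Differentiable ℝ V) (hV0 : ∀ x, 0 ≤ V x)
    (hVp : ∀ C, ∃ R, ∀ x, V x ≤ C → ‖x‖ ≤ R) {c : ℝ} (hc : 0 ≤ c)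
    (hL : ∀ x, lieDeriv F V x ≤ c * V x) {a b : ℝ} (hab : a ≤ b) (z : Space n) :
    ∃ x : ℝ → Space n, x a = z ∧ ContinuousOn x (Set.Icc a b) ∧
      ∀ t ∈ Set.Ico a b, HasDerivWithinAt x (F (x t)) (Set.Ici t) t := by
  -- `R` bounds every state that the growth estimate allows up to time `b`; the field is cut off
  -- only outside that ball.
  obtain ⟨R, hR⟩ := hVp (Real.exp (c * (b - a)) * V z)
  obtain ⟨L, hLb⟩ := exists_norm_cutoff_smul_le hF.continuous R
  have hG := locallyLipschitz_cutoff_smul hF R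
  -- At speed at most `L` a curve cannot leave this ball during `[a, b]`, so Picard–Lindelöf covers
  -- the whole interval.
  set r : ℝ≥0 := L * (b - a).toNNReal with hr
  obtain ⟨K, hK⟩ := exists_lipschitzOnWith_closedBall hG z r
  have hPL : IsPicardLindelof (fun _ x => cutoff R x • F x)
      (⟨a, Set.left_mem_Icc.2 hab⟩ : Set.Icc a b) z r 0 L K := by
    refine IsPicardLindelof.of_time_independent (fun x _ => hLb x) hK ?_
    have : 0 ≤ b - a := sub_nonneg.2 hab
    simp [hr, this]
  obtain ⟨x, hxa, hx⟩ := hPL.exists_eq_forall_mem_Icc_hasDerivWithinAt₀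
  have hxc : ContinuousOn x (Set.Icc a b) := fun t ht => (hx t ht).continuousWithinAt
  have hx' : ∀ t ∈ Set.Ico a b,
      HasDerivWithinAt x (cutoff R (x t) • F (x t)) (Set.Ici t) t := fun t ht =>
    (hx t (Set.Ico_subset_Icc_self ht)).mono_of_mem_nhdsWithin
      (mem_of_superset (Icc_mem_nhdsGE ht.2) (Set.Icc_subset_Icc_left ht.1))
  -- The truncated field obeys the same growth bound, because `c * V ≥ 0` and the cutoff lies in
  -- `[0, 1]`. Its solution therefore stays where the cutoff is 1.
  have hest := le_exp_mul_of_lieDeriv_le hV hxc hx' (c := c) fun t _ => by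
    rw [inner_smul_right]
    have h1 := hL (x t)
    rw [lieDeriv] at h1
    have h2 : 0 ≤ c * V (x t) := mul_nonneg hc (hV0 _)
    calc _ ≤ cutoff R (x t) * (c * V (x t)) :=
          mul_le_mul_of_nonneg_left h1 (cutoff_nonneg _ _)
      _ ≤ 1 * (c * V (x t)) := mul_le_mul_of_nonneg_right (cutoff_le_one _ _) h2
      _ = _ := one_mul _
  refine ⟨x, hxa, hxc, fun t ht => ?_⟩
  have hle : ‖x t‖ ≤ R := hR _ <| (hest t (Set.Ico_subset_Icc_self ht)).trans <| by
    have h0 : x a = z := hxa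
    rw [h0]
    gcongr
    · exact hV0 z
    · exact ht.2.le
  have := hx' t ht
  rwa [cutoff_eq_one hle, one_smul] at this

lemma IsRightSolution.mono {N : ℕ} {F : Fin N → Space n → Space n} {s : ℝ → Fin N} {a b a' b' : ℝ}
    {x : ℝ → Space n} (hx : IsRightSolution F s a b x) (ha : a ≤ a') (hb : b' ≤ b) :
    IsRightSolution F s a' b' x :=
  ⟨hx.continuousOn.mono (Set.Icc_subset_Icc ha hb),
    fun t ht => hx.hasDeriv t (Set.Ico_subset_Ico ha hb ht)⟩

/-- By compactness both curves lie in one ball, and as there are finitely many modes, the sum of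
their Lipschitz constants there serves at all times. Grönwall uniqueness needs only right
derivatives. -/
lemma IsRightSolution.eqOn {N : ℕ} {F : Fin N → Space n → Space n}
    (hF : ∀ i, LocallyLipschitz (F i)) {s : ℝ → Fin N} {a b : ℝ} {x y : ℝ → Space n}
    (hx : IsRightSolution F s a b x) (hy : IsRightSolution F s a b y) (hxy : x a = y a) :
    Set.EqOn x y (Set.Icc a b) := by
  obtain ⟨C, hC⟩ := isCompact_Icc.exists_bound_of_continuousOn hx.continuousOn
  obtain ⟨D, hD⟩ := isCompact_Icc.exists_bound_of_continuousOn hy.continuousOn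
  choose K hK using fun i =>
    exists_lipschitzOnWith_closedBall (hF i) 0 (max C D)
  refine ODE_solution_unique_of_mem_Icc_right (v := fun t => F (s t))
    (s := fun _ => Metric.closedBall 0 (max C D)) (K := ∑ i, K i)
    (fun t _ => (hK (s t)).weaken (Finset.single_le_sum (fun i _ => zero_le) (Finset.mem_univ _)))
    hx.continuousOn hx.hasDeriv (fun t ht => ?_) hy.continuousOn hy.hasDeriv (fun t ht => ?_) hxy
  · simpa using Or.inl (hC t (Set.Ico_subset_Icc_self ht))
  · simpa using Or.inr (hD t (Set.Ico_subset_Icc_self ht))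

/-- A right derivative at `b` sees only the second piece, so equality of values is the only matching
condition; this is why right derivatives suit switching. -/
lemma IsRightSolution.glue {N : ℕ} {F : Fin N → Space n → Space n} {s : ℝ → Fin N} {a b c : ℝ}
    {x y : ℝ → Space n} (hab : a ≤ b) (hbc : b ≤ c) (hx : IsRightSolution F s a b x)
    (hy : IsRightSolution F s b c y) (hxy : x b = y b) :
    IsRightSolution F s a c (fun t => if t < b then x t else y t) := by
  have hle : Set.EqOn (fun t => if t < b then x t else y t) x (Set.Iic b) := fun t ht => by
    rcases lt_or_eq_of_le (show t ≤ b from ht) with h | h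
    · simp [h]
    · simp [h, hxy]
  have hge : Set.EqOn (fun t => if t < b then x t else y t) y (Set.Ici b) := fun t ht => by
    simp [not_lt.2 (show b ≤ t from ht)]
  refine ⟨?_, fun t ht => ?_⟩
  · rw [← Set.Icc_union_Icc_eq_Icc hab hbc]
    refine ContinuousOn.union_of_isClosed ?_ ?_ isClosed_Icc isClosed_Icc
    · exact hx.continuousOn.congr (hle.mono fun t ht => ht.2)
    · exact hy.continuousOn.congr (hge.mono fun t ht => ht.1)
  · rcases lt_or_ge t b with h | h
    · have h1 := hx.hasDeriv t ⟨ht.1, h⟩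
      rw [show (if t < b then x t else y t) = x t from hle h.le]
      refine h1.congr_of_eventuallyEq ?_ (hle h.le)
      exact mem_nhdsWithin_of_mem_nhds (mem_of_superset (Iio_mem_nhds h) fun u hu => hle (show u ≤ b from le_of_lt hu))
    · have h1 := hy.hasDeriv t ⟨h, ht.2⟩
      rw [show (if t < b then x t else y t) = y t from hge h]
      exact h1.congr (fun u hu => hge (h.trans hu)) (hge h)

end Flow

/-! ### Solutions along a fixed mode path -/

/-- A piecewise constant path of modes on `[0, ∞)` with jump instants `τ₀ = 0 < τ₁ < ⋯ → ∞`. -/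
structure IsStepPath {N : ℕ} (s : ℝ → Fin N) (τ : ℕ → ℝ) : Prop where
  zero : τ 0 = 0
  strictMono : StrictMono τ
  const : ∀ k t, τ k ≤ t → t < τ (k + 1) → s t = s (τ k)
  tendsto : Tendsto τ atTop atTop

namespace IsStepPath

variable {N : ℕ} {s : ℝ → Fin N} {τ : ℕ → ℝ}

lemma exists_mem_Ico (hs : IsStepPath s τ) {t : ℝ} (ht : 0 ≤ t) :
    ∃ k, t ∈ Set.Ico (τ k) (τ (k + 1)) := by
  classical
  have hex : ∃ k, t < τ k := (hs.tendsto.eventually_gt_atTop t).exists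
  obtain ⟨k, hk⟩ : ∃ k, Nat.find hex = k + 1 := Nat.exists_eq_succ_of_ne_zero fun h => by
    have := Nat.find_spec hex
    rw [h, hs.zero] at this
    exact absurd this (not_lt.2 ht)
  refine ⟨k, not_lt.1 (Nat.find_min hex (by omega)), ?_⟩
  rw [← hk]
  exact Nat.find_spec hex

lemma nonneg (hs : IsStepPath s τ) (k : ℕ) : 0 ≤ τ k :=
  hs.zero ▸ hs.strictMono.monotone (Nat.zero_le k)

lemma eventuallyEq (hs : IsStepPath s τ) {t : ℝ} (ht : 0 ≤ t) : ∀ᶠ u in 𝓝[≥] t, s u = s t := by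
  obtain ⟨k, hk⟩ := hs.exists_mem_Ico ht
  filter_upwards [Ico_mem_nhdsGE hk.2] with u hu
  rw [hs.const k u (hk.1.trans hu.1) hu.2, hs.const k t hk.1 hk.2]

variable {n : ℕ} {F : Fin N → Space n → Space n}

lemma intervalIntegrable (hs : IsStepPath s τ) (hF : ∀ i, Continuous (F i)) {x : ℝ → Space n}
    (hx : ContinuousOn x (Set.Ici 0)) {t : ℝ} (ht : 0 ≤ t) :
    IntervalIntegrable (fun u => F (s u) (x u)) volume 0 t := by
  have key : ∀ k, IntervalIntegrable (fun u => F (s u) (x u)) volume (τ 0) (τ k) := fun k => by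
    refine IntervalIntegrable.trans_iterate fun j _ => ?_
    have hlt := hs.strictMono (Nat.lt_succ_self j)
    have h1 : IntervalIntegrable (fun u => F (s (τ j)) (x u)) volume (τ j) (τ (j + 1)) := by
      refine ContinuousOn.intervalIntegrable ((hF _).comp_continuousOn (hx.mono ?_))
      rw [Set.uIcc_of_le hlt.le]
      exact fun u hu => (hs.nonneg j).trans hu.1
    refine h1.congr_ae ?_
    -- The mode may change at the right endpoint, a null set.
    rw [Set.uIoc_of_le hlt.le, ← restrict_Ioo_eq_restrict_Ioc]
    refine (ae_restrict_mem measurableSet_Ioo).mono fun u hu => ?_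
    simp only
    rw [hs.const j u hu.1.le hu.2]
  obtain ⟨k, hk⟩ := (hs.tendsto.eventually_ge_atTop t).exists
  have h := key k
  rw [hs.zero] at h
  refine h.mono_set ?_
  rw [Set.uIcc_of_le ht, Set.uIcc_of_le (hs.nonneg k)]
  exact Set.Icc_subset_Icc_right hk

/-- The mode is constant just to the right of every instant, so the integrand is right-continuous
and the integral has a right derivative everywhere, switching instants included. -/
lemma isRightSolution (hs : IsStepPath s τ) (hF : ∀ i, Continuous (F i)) {x₀ : Space n}
    {x : ℝ → Space n} (hx : IsSolution F s x₀ x) (T : ℝ) : IsRightSolution F s 0 T x := by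
  refine ⟨hx.continuousOn.mono fun t ht => ht.1, fun t ht => ?_⟩
  have hsol : ∀ u ∈ Set.Ici t, x u = x₀ + ∫ v in (0 : ℝ)..u, F (s v) (x v) :=
    fun u hu => hx.eq_integral u (ht.1.trans hu)
  have hcont : ContinuousWithinAt (fun u => F (s u) (x u)) (Set.Ici t) t := by
    have h1 : ContinuousWithinAt (fun u => F (s t) (x u)) (Set.Ici t) t :=
      (hF _).continuousAt.comp_continuousWithinAt
        ((hx.continuousOn t ht.1).mono (Set.Ici_subset_Ici.2 ht.1))
    exact h1.congr_of_eventuallyEq ((hs.eventuallyEq ht.1).mono fun u hu => by simp only [hu]) rfl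
  have hmeas : StronglyMeasurableAtFilter (fun u => F (s u) (x u)) (𝓝[>] t) := by
    refine ⟨Set.Ioc t (t + 1), Ioc_mem_nhdsGT (lt_add_one t), ?_⟩
    refine ((hx.integrable (t + 1) (by linarith [ht.1])).1.mono_set ?_).aestronglyMeasurable
    exact Set.Ioc_subset_Ioc_left ht.1
  have h := intervalIntegral.integral_hasDerivWithinAt_right (hx.integrable t ht.1)
    (s := Set.Ici t) (t := Set.Ioi t) hmeas (hcont.mono Set.Ioi_subset_Ici_self)
  exact (h.const_add x₀).congr hsol (hsol t Set.self_mem_Ici)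

lemma isSolution (hs : IsStepPath s τ) (hF : ∀ i, Continuous (F i)) {x : ℝ → Space n}
    (hx : ∀ T, IsRightSolution F s 0 T x) : IsSolution F s (x 0) x := by
  have hxc : ContinuousOn x (Set.Ici 0) := fun t ht =>
    ((hx (t + 1)).continuousOn t ⟨ht, by linarith⟩).mono_of_mem_nhdsWithin <|
      mem_nhdsWithin.2 ⟨Set.Iio (t + 1), isOpen_Iio, lt_add_one t, fun u hu => ⟨hu.2, hu.1.le⟩⟩
  refine ⟨hxc, fun t ht => hs.intervalIntegrable hF hxc ht, fun t ht => ?_⟩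
  rw [intervalIntegral.integral_eq_sub_of_hasDeriv_right_of_le ht (hx t).continuousOn
    (fun u hu => ((hx t).hasDeriv u ⟨hu.1.le, hu.2⟩).mono Set.Ioi_subset_Ici_self)
    (hs.intervalIntegrable hF hxc ht)]
  abel

/-- If each mode has solutions on compact intervals, the switched system has exactly one solution. -/
lemma existsUnique_solution (hs : IsStepPath s τ) (hF : ∀ i, LocallyLipschitz (F i))
    (hex : ∀ i a b, a ≤ b → ∀ z, ∃ x : ℝ → Space n, x a = z ∧ ContinuousOn x (Set.Icc a b) ∧
      ∀ t ∈ Set.Ico a b, HasDerivWithinAt x (F i (x t)) (Set.Ici t) t) (x₀ : Space n) :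
    ∃ x, IsSolution F s x₀ x ∧ ∀ y, IsSolution F s x₀ y → Set.EqOn y x (Set.Ici 0) := by
  have hFc : ∀ i, Continuous (F i) := fun i => (hF i).continuous
  have step : ∀ k, ∃ x : ℝ → Space n, x 0 = x₀ ∧ IsRightSolution F s 0 (τ k) x := fun k => by
    induction k with
    | zero =>
      refine ⟨fun _ => x₀, rfl, continuousOn_const, fun t ht => ?_⟩
      rw [hs.zero] at ht
      exact absurd ht.2 (not_lt.2 ht.1)
    | succ k ih =>
      obtain ⟨x, hx0, hx⟩ := ih
      have hlt := hs.strictMono (Nat.lt_succ_self k)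
      obtain ⟨y, hy0, hyc, hy⟩ := hex (s (τ k)) _ _ hlt.le (x (τ k))
      have hyS : IsRightSolution F s (τ k) (τ (k + 1)) y := ⟨hyc, fun t ht => by
        rw [hs.const k t ht.1 ht.2]
        exact hy t ht⟩
      refine ⟨_, ?_, hx.glue (hs.nonneg k) hlt.le hyS hy0.symm⟩
      rcases (hs.nonneg k).lt_or_eq with h | h
      · simp [h, hx0]
      · simp only [← h, lt_irrefl, if_false]
        rw [← h] at hy0
        rw [hy0, hx0]
  have hT : ∀ T, ∃ x : ℝ → Space n, x 0 = x₀ ∧ IsRightSolution F s 0 T x := fun T => by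
    obtain ⟨k, hk⟩ := (hs.tendsto.eventually_ge_atTop T).exists
    obtain ⟨x, hx0, hx⟩ := step k
    exact ⟨x, hx0, hx.mono le_rfl hk⟩
  choose X hX0 hX using hT
  -- By uniqueness, solutions on different horizons agree where both are defined, so one diagonal
  -- curve extends them all.
  have hXX : ∀ T, Set.EqOn (fun t => X (t + 1) t) (X T) (Set.Icc 0 T) := fun T t ht =>
    ((hX (t + 1)).mono (b' := t) le_rfl (by linarith)).eqOn hF ((hX T).mono le_rfl ht.2)
      (by rw [hX0, hX0]) ⟨ht.1, le_rfl⟩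
  have hsol : ∀ T, IsRightSolution F s 0 T (fun t => X (t + 1) t) := fun T => by
    refine ⟨(hX T).continuousOn.congr (hXX T), fun t ht => ?_⟩
    have h1 := (hX T).hasDeriv t ht
    have h2 := hXX T (Set.Ico_subset_Icc_self ht)
    simp only at h2
    simp only [h2]
    refine h1.congr_of_eventuallyEq ?_ h2
    filter_upwards [Ico_mem_nhdsGE ht.2] with u hu
    exact hXX T ⟨ht.1.trans hu.1, hu.2.le⟩
  have hX1 : X (0 + 1) 0 = x₀ := hX0 _
  have hS := hs.isSolution hFc hsol
  rw [hX1] at hS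
  refine ⟨_, hS, fun y hy t ht => ?_⟩
  have hy0 : y 0 = x₀ := by simpa using hy.eq_integral 0 le_rfl
  exact (hs.isRightSolution hFc hy t).eqOn hF (hsol t) (hy0.trans hX1.symm) ⟨ht, le_rfl⟩

end IsStepPath

/-! ### Expectations of products over modes and holding times -/

section Probability

variable {Ω : Type*} [MeasurableSpace Ω] {P : Measure Ω} {N : ℕ}
  {σ : ℝ → Ω → Fin N} {σ₀ : Fin N} {τ : ℕ → Ω → ℝ} {rate : ℝ} {q : Fin N → ℝ}

lemma IsSwitchingInstants.nonneg (hτ : IsSwitchingInstants σ τ) (k : ℕ) (ω : Ω) : 0 ≤ τ k ω :=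
  hτ.zero ω ▸ (hτ.strictMono ω).monotone (Nat.zero_le k)

lemma IsSwitchingInstants.measurable_holding (hτ : IsSwitchingInstants σ τ) (k : ℕ) :
    Measurable (holding τ k) :=
  (hτ.measurable (k + 1)).sub (hτ.measurable k)

/-- A right-continuous process evaluated at a random time is measurable. -/
lemma IsSwitchingSignal.measurable_comp (hσ : IsSwitchingSignal σ σ₀) {T : Ω → ℝ}
    (hT : Measurable T) (hT0 : ∀ ω, 0 ≤ T ω) : Measurable fun ω => σ (T ω) ω := by
  -- The next point after `t` of the grid of mesh `1 / (m + 1)`: it takes countably many values, and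
  -- it tends to `t` from the right, where paths are continuous.
  let a : ℕ → ℝ → ℝ := fun m t => (⌊((m : ℝ) + 1) * t⌋₊ + 1) / ((m : ℝ) + 1)
  have ha : ∀ m t, 0 ≤ t → t ≤ a m t ∧ a m t ≤ t + 1 / ((m : ℝ) + 1) := fun m t ht => by
    have hm : (0 : ℝ) < (m : ℝ) + 1 := by positivity
    constructor
    · rw [le_div_iff₀ hm, mul_comm]
      exact (Nat.lt_floor_add_one _).le
    · have h1 : (⌊((m : ℝ) + 1) * t⌋₊ : ℝ) ≤ ((m : ℝ) + 1) * t := Nat.floor_le (by positivity)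
      have h2 : (t + 1 / ((m : ℝ) + 1)) * ((m : ℝ) + 1) = ((m : ℝ) + 1) * t + 1 := by field_simp
      rw [div_le_iff₀ hm, h2]
      linarith
  refine measurable_of_tendsto_metrizable (f := fun m ω => σ (a m (T ω)) ω) (fun m => ?_) ?_
  · have h1 : Measurable fun p : ℕ × Ω => σ (((p.1 : ℝ) + 1) / ((m : ℝ) + 1)) p.2 := by
      refine measurable_from_prod_countable_right fun l => ?_
      have hl : 0 ≤ ((l : ℝ) + 1) / ((m : ℝ) + 1) := by positivity
      exact hσ.measurable _ hl
    exact h1.comp ((Nat.measurable_floor.comp (hT.const_mul _)).prodMk measurable_id)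
  · rw [tendsto_pi_nhds]
    intro ω
    refine (hσ.right_continuous ω (T ω) (hT0 ω)).tendsto.comp (tendsto_nhdsWithin_iff.2 ⟨?_, ?_⟩)
    · refine tendsto_of_tendsto_of_tendsto_of_le_of_le tendsto_const_nhds
        (h := fun m : ℕ => T ω + 1 / ((m : ℝ) + 1)) ?_
        (fun m => (ha m _ (hT0 ω)).1) (fun m => (ha m _ (hT0 ω)).2)
      simpa using tendsto_one_div_add_atTop_nhds_zero_nat.const_add (T ω)
    · exact Eventually.of_forall fun m => (ha m _ (hT0 ω)).1

lemma measurable_dest (hσ : IsSwitchingSignal σ σ₀) (hτ : IsSwitchingInstants σ τ) (k : ℕ) :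
    Measurable (dest σ τ k) :=
  hσ.measurable_comp (hτ.measurable k) (hτ.nonneg k)

lemma dest_zero (hσ : IsSwitchingSignal σ σ₀) (hτ : IsSwitchingInstants σ τ) (ω : Ω) :
    dest σ τ 0 ω = σ₀ := by
  rw [dest, hτ.zero, hσ.initial]

/-- The information carried by the modes before the `j`-th switching instant. -/
@[reducible] def destPast (σ : ℝ → Ω → Fin N) (τ : ℕ → Ω → ℝ) (j : ℕ) : MeasurableSpace Ω :=
  ⨆ k : Fin j, MeasurableSpace.comap (dest σ τ k) ⊤

lemma destPast_le (hσ : IsSwitchingSignal σ σ₀) (hτ : IsSwitchingInstants σ τ) (j : ℕ) :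
    destPast σ τ j ≤ ‹MeasurableSpace Ω› :=
  iSup_le fun k => (measurable_dest hσ hτ k).comap_le

omit [MeasurableSpace Ω] in
lemma measurable_destPast {j k : ℕ} (hkj : k < j) (φ : Fin N → ℝ≥0∞) :
    Measurable[destPast σ τ j] fun ω => φ (dest σ τ k ω) := by
  have h : Measurable[destPast σ τ j] (dest σ τ k) := by
    rw [measurable_iff_comap_le]
    exact le_iSup (fun k : Fin j => MeasurableSpace.comap (dest σ τ k) ⊤) ⟨k, hkj⟩
  exact (measurable_of_countable φ).comp h

variable [IsProbabilityMeasure P]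

/-- (EH2) integrated over an event of the past: a constant conditional probability means
independence of the past. -/
lemma ClassEH.measure_inter_dest (hσ : IsSwitchingSignal σ σ₀) (h : ClassEH P σ τ rate q) {j : ℕ}
    (hj : 1 ≤ j) (i : Fin N) {A : Set Ω} (hA : MeasurableSet[destPast σ τ j] A) :
    P (A ∩ {ω | dest σ τ j ω = i}) = P A * ENNReal.ofReal (q i) := by
  have hm := destPast_le hσ h.instants j
  have hB : MeasurableSet {ω | dest σ τ j ω = i} :=
    measurable_dest hσ h.instants j (measurableSet_singleton i)
  have h1 := setIntegral_condExp (μ := P) hm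
    ((integrable_const (1 : ℝ)).indicator hB) hA
  have h2 : ∫ ω in A, (P⟦{ω | dest σ τ j ω = i} | destPast σ τ j⟧) ω ∂P = ∫ _ in A, q i ∂P :=
    integral_congr_ae (ae_restrict_of_ae (h.dest_law i j hj))
  rw [h2, integral_indicator hB, Measure.restrict_restrict hB, Set.inter_comm] at h1
  simp only [integral_const, smul_eq_mul, mul_one, measureReal_restrict_apply_univ] at h1
  rw [← ENNReal.toReal_eq_toReal_iff' (measure_ne_top _ _) (by finiteness), ENNReal.toReal_mul,
    ENNReal.toReal_ofReal (h.q_mem i).1]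
  exact h1.symm

/-- Each new mode is independent of the earlier ones and has law `q`, so it splits off one factor.
The initial mode is deterministic, whence `φ σ₀` and only `k` powers. -/
lemma ClassEH.lintegral_prod_dest (hσ : IsSwitchingSignal σ σ₀) (h : ClassEH P σ τ rate q)
    (φ : Fin N → ℝ≥0∞) (k : ℕ) :
    ∫⁻ ω, ∏ j ∈ Finset.range (k + 1), φ (dest σ τ j ω) ∂P =
      φ σ₀ * (∑ i, ENNReal.ofReal (q i) * φ i) ^ k := by
  induction k with
  | zero => simp [dest_zero hσ h.instants]
  | succ k ih =>
    have hm := destPast_le hσ h.instants (k + 1)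
    have hB : ∀ i, MeasurableSet {ω | dest σ τ (k + 1) ω = i} := fun i =>
      measurable_dest hσ h.instants (k + 1) (measurableSet_singleton i)
    have hZ : Measurable[destPast σ τ (k + 1)]
        fun ω => ∏ j ∈ Finset.range (k + 1), φ (dest σ τ j ω) :=
      Finset.measurable_fun_prod _ fun j hj => measurable_destPast (Finset.mem_range.1 hj) φ
    -- Splitting by the value of the last mode reduces the product rule to indicators of events
    -- independent of the past.
    have hφ : ∀ ω, φ (dest σ τ (k + 1) ω) =
        ∑ i, {ω | dest σ τ (k + 1) ω = i}.indicator (fun _ => φ i) ω := fun ω => by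
      simp [Set.indicator_apply]
    have hP : ∀ i, P {ω | dest σ τ (k + 1) ω = i} = ENNReal.ofReal (q i) := fun i => by
      have := h.measure_inter_dest hσ (Nat.le_add_left 1 k) i MeasurableSet.univ
      simpa using this
    simp_rw [Finset.prod_range_succ _ (k + 1), hφ, Finset.mul_sum]
    rw [lintegral_finsetSum _ fun i _ =>
      (hZ.mono hm le_rfl).fun_mul (measurable_const.indicator (hB i))]
    have hterm : ∀ i, ∫⁻ ω, (∏ j ∈ Finset.range (k + 1), φ (dest σ τ j ω)) *
        {ω | dest σ τ (k + 1) ω = i}.indicator (fun _ => φ i) ω ∂P =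
        (φ σ₀ * (∑ i, ENNReal.ofReal (q i) * φ i) ^ k) * (ENNReal.ofReal (q i) * φ i) :=
      fun i => by
      rw [lintegral_mul_indicator_eq_lintegral_mul_lintegral_indicator hm _ (hB i) _ hZ, ih,
        lintegral_indicator_const (hB i), hP i, mul_comm (φ i)]
      rw [IndepSets_iff]
      rintro A B hA rfl
      rw [h.measure_inter_dest hσ (Nat.le_add_left 1 k) i hA, hP i]
    simp_rw [hterm]
    rw [← Finset.mul_sum, pow_succ, mul_assoc]

/-- Not part of the class EH hypotheses; it follows from the product formula with `φ = 1`. -/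
lemma ClassEH.sum_q (hσ : IsSwitchingSignal σ σ₀) (h : ClassEH P σ τ rate q) : ∑ i, q i = 1 := by
  have h1 := h.lintegral_prod_dest hσ (fun _ => 1) 1
  simp only [Finset.prod_const_one, lintegral_const, measure_univ, mul_one, one_mul, pow_one] at h1
  rw [← ENNReal.ofReal_sum_of_nonneg fun i _ => (h.q_mem i).1] at h1
  exact (ENNReal.ofReal_eq_one.1 h1.symm)

/-- With the modes frozen, (EH3) leaves the holding times i.i.d. exponential. Integrating them out
first leaves a product over modes alone. -/
lemma ClassEH.lintegral_prod (hσ : IsSwitchingSignal σ σ₀) (h : ClassEH P σ τ rate q)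
    {H : Fin N → ℝ → ℝ≥0∞} (hH : ∀ i, Measurable (H i)) (k : ℕ) :
    ∫⁻ ω, ∏ j ∈ Finset.range (k + 1), H (dest σ τ j ω) (holding τ j ω) ∂P =
      (∫⁻ s, H σ₀ s ∂expMeasure rate) *
        (∑ i, ENNReal.ofReal (q i) * ∫⁻ s, H i s ∂expMeasure rate) ^ k := by
  have hS := h.instants.measurable_holding
  have hD := measurable_dest hσ h.instants
  have hS' : Measurable fun ω k => holding τ k ω := measurable_pi_lambda _ hS
  have hD' : Measurable fun ω k => dest σ τ k ω := measurable_pi_lambda _ hD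
  have hHu : Measurable fun p : Fin N × ℝ => H p.1 p.2 :=
    measurable_from_prod_countable_right hH
  have hG : Measurable fun p : (ℕ → ℝ) × (ℕ → Fin N) =>
      ∏ j ∈ Finset.range (k + 1), H (p.2 j) (p.1 j) :=
    Finset.measurable_fun_prod _ fun j _ =>
      hHu.comp (f := fun p : (ℕ → ℝ) × (ℕ → Fin N) => (p.2 j, p.1 j)) (by fun_prop)
  have hprod := h.indep.map_prod_eq_prod_map_map hS'.aemeasurable hD'.aemeasurable
  have : IsProbabilityMeasure (P.map fun ω k => holding τ k ω) :=
    Measure.isProbabilityMeasure_map hS'.aemeasurable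
  have : IsProbabilityMeasure (P.map fun ω k => dest σ τ k ω) :=
    Measure.isProbabilityMeasure_map hD'.aemeasurable
  have hlaw : ∀ i j, ∫⁻ ω, H i (holding τ j ω) ∂P = ∫⁻ s, H i s ∂expMeasure rate := fun i j => by
    rw [← (h.holding_law j).map_eq, lintegral_map (hH i) (hS j)]
  rw [← h.lintegral_prod_dest hσ (fun i => ∫⁻ s, H i s ∂expMeasure rate)]
  calc _ = ∫⁻ p, ∏ j ∈ Finset.range (k + 1), H (p.2 j) (p.1 j)
        ∂(P.map fun ω => ((fun k => holding τ k ω), fun k => dest σ τ k ω)) :=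
        (lintegral_map hG (hS'.prodMk hD')).symm
    _ = ∫⁻ d, ∫⁻ s, ∏ j ∈ Finset.range (k + 1), H (d j) (s j)
        ∂(P.map fun ω k => holding τ k ω) ∂(P.map fun ω k => dest σ τ k ω) := by
        rw [hprod, lintegral_prod_symm' _ hG]
    _ = ∫⁻ d, ∏ j ∈ Finset.range (k + 1), ∫⁻ s, H (d j) s ∂expMeasure rate
        ∂(P.map fun ω k => dest σ τ k ω) := by
        refine lintegral_congr fun d => ?_
        have hGd : Measurable fun s : ℕ → ℝ => ∏ j ∈ Finset.range (k + 1), H (d j) (s j) :=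
          Finset.measurable_fun_prod _ fun j _ => (hH (d j)).comp (measurable_pi_apply j)
        rw [lintegral_map hGd hS']
        exact (lintegral_prod_eq_prod_lintegral_of_indepFun _
          (fun j ω => H (d j) (holding τ j ω))
          (h.holding_indep.comp (fun j => H (d j)) fun j => hH _)
          fun j => (hH _).comp (hS j)).trans (Finset.prod_congr rfl fun j _ => hlaw _ j)
    _ = _ := by
        refine lintegral_map (Finset.measurable_fun_prod _ fun j _ => ?_) hD'
        exact (measurable_of_countable fun i => ∫⁻ s, H i s ∂expMeasure rate).comp
          (measurable_pi_apply j)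

/-- Exponential tilting: `exp (-l s)` times the density of rate `r` is `r / (l + r)` times that of
rate `l + r`. Only `l + r > 0` matters, so `l` may be negative. -/
lemma lintegral_exp_expMeasure {r l : ℝ} (hr : 0 < r) (hl : 0 < l + r) {μ : ℝ} (hμ : 0 ≤ μ) :
    ∫⁻ s, ENNReal.ofReal (μ * Real.exp (-l * s)) ∂expMeasure r =
      ENNReal.ofReal (μ / (1 + l / r)) := by
  have hm : Measurable (exponentialPDF r) := (measurable_exponentialPDFReal r).ennreal_ofReal
  have heq : expMeasure r = volume.withDensity (exponentialPDF r) := rfl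
  have hpos : 0 ≤ μ / (1 + l / r) := by
    have : 1 + l / r = (l + r) / r := by field_simp; ring
    rw [this]; positivity
  rw [heq, lintegral_withDensity_eq_lintegral_mul _ hm (by fun_prop)]
  calc _ = ∫⁻ s, ENNReal.ofReal (μ / (1 + l / r)) * exponentialPDF (l + r) s := by
        refine lintegral_congr fun s => ?_
        rw [Pi.mul_apply]
        rcases lt_or_ge s 0 with hs | hs
        · simp [exponentialPDF_of_neg hs]
        · rw [exponentialPDF_of_nonneg hs, exponentialPDF_of_nonneg hs,
            ← ENNReal.ofReal_mul (by positivity), ← ENNReal.ofReal_mul hpos]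
          congr 1
          have : Real.exp (-((l + r) * s)) = Real.exp (-(r * s)) * Real.exp (-l * s) := by
            rw [← Real.exp_add]; congr 1; ring
          rw [this]
          have : r + l ≠ 0 := by linarith
          have : l + r ≠ 0 := by linarith
          field_simp
          ring
    _ = _ := by
        rw [lintegral_const_mul _
          (show Measurable (exponentialPDF _) from (measurable_exponentialPDFReal _).ennreal_ofReal),
          lintegral_exponentialPDF_eq_one hl, mul_one]

/-- Under the mean contractivity condition, the random products of growth factors over the
successive holding intervals tend to zero almost surely. -/
lemma ClassEH.ae_tendsto_prod (hσ : IsSwitchingSignal σ σ₀) (h : ClassEH P σ τ rate q)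
    {μ : ℝ} (hμ : 0 ≤ μ) {lam : Fin N → ℝ} (hlam : ∀ i, 0 < lam i + rate)
    (hc : ∑ i, μ * q i / (1 + lam i / rate) < 1) :
    ∀ᵐ ω ∂P, Tendsto (fun k => ∏ j ∈ Finset.range k,
      (μ * Real.exp (-lam (dest σ τ j ω) * holding τ j ω))) atTop (𝓝 0) := by
  have hr := h.rate_pos
  let H : Fin N → ℝ → ℝ≥0∞ := fun i s => ENNReal.ofReal (μ * Real.exp (-lam i * s))
  have hH : ∀ i, Measurable (H i) := fun i => by fun_prop
  have hI : ∀ i, ∫⁻ s, H i s ∂expMeasure rate = ENNReal.ofReal (μ / (1 + lam i / rate)) :=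
    fun i => lintegral_exp_expMeasure hr (hlam i) hμ
  have hnn : ∀ i, 0 ≤ μ / (1 + lam i / rate) := fun i => by
    have h1 : 1 + lam i / rate = (lam i + rate) / rate := by field_simp; ring
    have := hlam i
    rw [h1]; positivity
  have hsum : ∑ i, ENNReal.ofReal (q i) * ∫⁻ s, H i s ∂expMeasure rate < 1 := by
    simp_rw [hI, ← ENNReal.ofReal_mul (h.q_mem _).1]
    rw [← ENNReal.ofReal_sum_of_nonneg fun i _ => mul_nonneg (h.q_mem i).1 (hnn i),
      ENNReal.ofReal_lt_one]
    convert hc using 2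
    ring
  let M : ℕ → Ω → ℝ≥0∞ := fun k ω =>
    ∏ j ∈ Finset.range (k + 1), H (dest σ τ j ω) (holding τ j ω)
  have hM : ∀ k, Measurable (M k) := fun k => Finset.measurable_fun_prod _ fun j _ =>
    (measurable_from_prod_countable_right hH : Measurable fun p : Fin N × ℝ => H p.1 p.2).comp
      ((measurable_dest hσ h.instants j).prodMk (h.instants.measurable_holding j))
  -- The expected sum is a geometric series of ratio less than 1, so the random series is finite
  -- almost surely and its terms vanish.
  have hfin : ∫⁻ ω, ∑' k, M k ω ∂P ≠ ∞ := by
    rw [lintegral_tsum fun k => (hM k).aemeasurable]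
    simp_rw [M, h.lintegral_prod hσ hH]
    rw [ENNReal.tsum_mul_left, ENNReal.tsum_geometric, hI]
    refine ENNReal.mul_ne_top ENNReal.ofReal_ne_top (ENNReal.inv_ne_top.2 ?_)
    exact (tsub_pos_of_lt hsum).ne'
  filter_upwards [ae_lt_top (Measurable.tsum hM) hfin] with ω hω
  have h1 := (ENNReal.tendsto_toReal ENNReal.zero_ne_top).comp
    (ENNReal.tendsto_atTop_zero_of_tsum_ne_top hω.ne)
  rw [← tendsto_add_atTop_iff_nat 1]
  refine h1.congr fun k => ?_
  simp only [Function.comp, M, ENNReal.toReal_prod, H]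
  exact Finset.prod_congr rfl fun j _ => ENNReal.toReal_ofReal (by positivity)

/-- With `μ = 1` and all rates 1 the product telescopes to `exp (-τ k)`; the contraction condition
becomes `1 / (1 + 1 / rate) < 1`. -/
lemma ClassEH.ae_tendsto_instants (hσ : IsSwitchingSignal σ σ₀) (h : ClassEH P σ τ rate q) :
    ∀ᵐ ω ∂P, Tendsto (fun k => τ k ω) atTop atTop := by
  have hr := h.rate_pos
  have key := h.ae_tendsto_prod hσ zero_le_one (lam := fun _ => 1) (fun _ => by positivity) (by
    rw [← Finset.sum_div, ← Finset.mul_sum, h.sum_q hσ, mul_one, div_lt_one (by positivity)]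
    have : 0 < 1 / rate := by positivity
    linarith)
  filter_upwards [key] with ω hω
  have h1 : ∀ k, ∏ j ∈ Finset.range k, (1 * Real.exp (-1 * holding τ j ω)) =
      Real.exp (-τ k ω) := fun k => by
    simp_rw [one_mul]
    rw [← Real.exp_sum, ← Finset.mul_sum]
    simp only [holding]
    rw [Finset.sum_range_sub (fun k => τ k ω), h.instants.zero]
    simp
  simp_rw [h1] at hω
  rw [Real.tendsto_exp_comp_nhds_zero] at hω
  exact tendsto_neg_atBot_iff.1 hω

end Probability

/-! ### Pathwise stability from decay of the growth factors -/

section Stability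

variable {n N : ℕ} {F : Fin N → Space n → Space n} {s : ℝ → Fin N} {τ : ℕ → ℝ}
  {V : Fin N → Space n → ℝ} {μ : ℝ} {lam : Fin N → ℝ}

/-- The growth factor of the Lyapunov functions up to the `k`-th switching instant. -/
noncomputable def growth (s : ℝ → Fin N) (τ : ℕ → ℝ) (μ : ℝ) (lam : Fin N → ℝ) (k : ℕ) : ℝ :=
  ∏ j ∈ Finset.range k, (μ * Real.exp (-lam (s (τ j)) * (τ (j + 1) - τ j)))

lemma growth_nonneg (hμ : 0 ≤ μ) (k : ℕ) : 0 ≤ growth s τ μ lam k :=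
  Finset.prod_nonneg fun _ _ => mul_nonneg hμ (Real.exp_pos _).le

lemma IsStepPath.le_exp_mul (hs : IsStepPath s τ) (hF : ∀ i, Continuous (F i))
    (hV : ∀ i, Differentiable ℝ (V i)) (hL : ∀ i x, lieDeriv (F i) (V i) x ≤ -lam i * V i x)
    {x₀ : Space n} {x : ℝ → Space n} (hx : IsSolution F s x₀ x) (k : ℕ) :
    ∀ t ∈ Set.Icc (τ k) (τ (k + 1)),
      V (s (τ k)) (x t) ≤ Real.exp (-lam (s (τ k)) * (t - τ k)) * V (s (τ k)) (x (τ k)) := by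
  have hR := (hs.isRightSolution hF hx (τ (k + 1))).mono (hs.nonneg k) le_rfl
  refine le_exp_mul_of_lieDeriv_le (hV _) hR.continuousOn hR.hasDeriv fun t ht => ?_
  rw [hs.const k t ht.1 ht.2]
  exact hL _ _

lemma IsStepPath.le_growth_mul (hs : IsStepPath s τ) (hF : ∀ i, Continuous (F i))
    (hV : ∀ i, Differentiable ℝ (V i)) (hL : ∀ i x, lieDeriv (F i) (V i) x ≤ -lam i * V i x)
    (hμ : 0 ≤ μ) (hV3 : ∀ i j x, V i x ≤ μ * V j x)
    {x₀ : Space n} {x : ℝ → Space n} (hx : IsSolution F s x₀ x) (k : ℕ) :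
    V (s (τ k)) (x (τ k)) ≤ growth s τ μ lam k * V (s 0) x₀ := by
  induction k with
  | zero =>
    have hx0 : x 0 = x₀ := by simpa using hx.eq_integral 0 le_rfl
    simp [growth, hs.zero, hx0]
  | succ k ih =>
    have h1 := hs.le_exp_mul hF hV hL hx k (τ (k + 1))
      ⟨(hs.strictMono (Nat.lt_succ_self k)).le, le_rfl⟩
    rw [growth, Finset.prod_range_succ, ← growth]
    calc V (s (τ (k + 1))) (x (τ (k + 1))) ≤ μ * V (s (τ k)) (x (τ (k + 1))) := hV3 _ _ _
      _ ≤ μ * (Real.exp (-lam (s (τ k)) * (τ (k + 1) - τ k)) *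
          (growth s τ μ lam k * V (s 0) x₀)) := by
          refine mul_le_mul_of_nonneg_left (h1.trans ?_) hμ
          exact mul_le_mul_of_nonneg_left ih (Real.exp_pos _).le
      _ = _ := by ring

/-- Inside a holding interval the exponential lies between 1 and its end value `e`, in an order set
by the sign of the rate. As `μ ≥ 1`, `1 + μ * e` covers both cases and produces two consecutive
growth factors. -/
lemma IsStepPath.le_growth_add_mul (hs : IsStepPath s τ) (hF : ∀ i, Continuous (F i))
    (hV : ∀ i, Differentiable ℝ (V i)) (hV0 : ∀ i x, 0 ≤ V i x)
    (hL : ∀ i x, lieDeriv (F i) (V i) x ≤ -lam i * V i x)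
    (hμ : 1 ≤ μ) (hV3 : ∀ i j x, V i x ≤ μ * V j x)
    {x₀ : Space n} {x : ℝ → Space n} (hx : IsSolution F s x₀ x) {k : ℕ} {t : ℝ}
    (ht : t ∈ Set.Ico (τ k) (τ (k + 1))) :
    V (s (τ k)) (x t) ≤
      (growth s τ μ lam k + growth s τ μ lam (k + 1)) * V (s 0) x₀ := by
  have h1 := hs.le_exp_mul hF hV hL hx k t (Set.Ico_subset_Icc_self ht)
  have h2 := hs.le_growth_mul hF hV hL (zero_le_one.trans hμ) hV3 hx k
  set e := Real.exp (-lam (s (τ k)) * (τ (k + 1) - τ k)) with he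
  have h3 : Real.exp (-lam (s (τ k)) * (t - τ k)) ≤ 1 + μ * e := by
    have hle : t - τ k ≤ τ (k + 1) - τ k := by linarith [ht.2]
    have h0 : 0 ≤ t - τ k := sub_nonneg.2 ht.1
    have hep : 0 < e := Real.exp_pos _
    rcases le_total 0 (lam (s (τ k))) with hl | hl
    · have : Real.exp (-lam (s (τ k)) * (t - τ k)) ≤ 1 :=
        Real.exp_le_one_iff.2 (mul_nonpos_of_nonpos_of_nonneg (by linarith) h0)
      have : 0 ≤ μ * e := by positivity
      linarith
    · have : Real.exp (-lam (s (τ k)) * (t - τ k)) ≤ e :=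
        Real.exp_le_exp.2 (mul_le_mul_of_nonneg_left hle (by linarith))
      nlinarith
  have hg : growth s τ μ lam (k + 1) = growth s τ μ lam k * (μ * e) := by
    rw [growth, Finset.prod_range_succ, ← growth]
  have hW := hV0 (s (τ k)) (x (τ k))
  have hep : 0 ≤ 1 + μ * e := (Real.exp_pos _).le.trans h3
  calc V (s (τ k)) (x t) ≤ (1 + μ * e) * V (s (τ k)) (x (τ k)) :=
        h1.trans (mul_le_mul_of_nonneg_right h3 hW)
    _ ≤ (1 + μ * e) * (growth s τ μ lam k * V (s 0) x₀) := mul_le_mul_of_nonneg_left h2 hep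
    _ = _ := by rw [hg]; ring

/-- Strict pointwise bounds survive only weakly in a supremum, hence `ε / 2`. -/
lemma iSup_enorm_lt_of_norm_lt {x : ℝ → Space n} {T ε : ℝ} (hε : 0 < ε)
    (hx : ∀ t, T ≤ t → ‖x t‖ < ε / 2) : ⨆ t ∈ Set.Ici T, ‖x t‖ₑ < ENNReal.ofReal ε := by
  refine lt_of_le_of_lt (iSup₂_le fun t ht => ?_)
    (ENNReal.ofReal_lt_ofReal_iff_of_nonneg (by positivity) |>.2 (half_lt_self hε))
  rw [← ofReal_norm]
  exact ENNReal.ofReal_le_ofReal (hx t ht).le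

lemma ClassKInfty.norm_lt {α : ℝ≥0 → ℝ≥0} (hα : ClassKInfty α) {x : Space n} {r : ℝ} (hr : 0 ≤ r)
    (h : (α ‖x‖₊ : ℝ) < α r.toNNReal) : ‖x‖ < r := by
  have h1 := hα.strictMono.lt_iff_lt.1 (NNReal.coe_lt_coe.1 h)
  rwa [← NNReal.coe_lt_coe, Real.coe_toNNReal _ hr] at h1

lemma ClassKInfty.pos {α : ℝ≥0 → ℝ≥0} (hα : ClassKInfty α) {r : ℝ} (hr : 0 < r) :
    (0 : ℝ) < α r.toNNReal := by
  have := hα.strictMono (Real.toNNReal_pos.2 hr)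
  rw [hα.map_zero] at this
  exact_mod_cast this

/-- Bounded sublevel sets: the properness that excludes finite escape. -/
lemma ClassKInfty.exists_norm_le {α : ℝ≥0 → ℝ≥0} (hα : ClassKInfty α) {V : Space n → ℝ}
    (hV : ∀ x, (α ‖x‖₊ : ℝ) ≤ V x) (C : ℝ) : ∃ R, ∀ x, V x ≤ C → ‖x‖ ≤ R := by
  obtain ⟨R, hR⟩ := (hα.unbounded.eventually_gt_atTop C.toNNReal).exists
  refine ⟨R, fun x hx => (hα.norm_lt (NNReal.coe_nonneg R) ?_).le⟩
  rw [Real.toNNReal_coe]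
  calc (α ‖x‖₊ : ℝ) ≤ C := (hV x).trans hx
    _ ≤ C.toNNReal := Real.le_coe_toNNReal C
    _ < α R := NNReal.coe_lt_coe.2 hR

variable {α₁ α₂ : ℝ≥0 → ℝ≥0}

/-- Pathwise stability of the switched system when the growth factors tend to zero. -/
lemma IsStepPath.stable (hs : IsStepPath s τ) (hF : ∀ i, Continuous (F i))
    (hV : ∀ i, Differentiable ℝ (V i)) (hα₁ : ClassKInfty α₁) (hα₂ : ClassKInfty α₂)
    (hV1 : ∀ i x, (α₁ ‖x‖₊ : ℝ) ≤ V i x ∧ V i x ≤ (α₂ ‖x‖₊ : ℝ))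
    (hL : ∀ i x, lieDeriv (F i) (V i) x ≤ -lam i * V i x)
    (hμ : 1 ≤ μ) (hV3 : ∀ i j x, V i x ≤ μ * V j x)
    (hg : Tendsto (growth s τ μ lam) atTop (𝓝 0)) {ε : ℝ} (hε : 0 < ε) :
    ∃ δ : ℝ, 0 < δ ∧ ∀ x₀ x, IsSolution F s x₀ x → ‖x₀‖ < δ →
      ⨆ t ∈ Set.Ici (0 : ℝ), ‖x t‖ₑ < ENNReal.ofReal ε := by
  have hV0 : ∀ i x, 0 ≤ V i x := fun i x => (NNReal.coe_nonneg (α₁ ‖x‖₊)).trans (hV1 i x).1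
  obtain ⟨C, hC⟩ := hg.bddAbove_range
  have hC' : ∀ k, growth s τ μ lam k ≤ C := fun k => hC ⟨k, rfl⟩
  have hcont : Tendsto (fun x : Space n => (C + C) * (α₂ ‖x‖₊ : ℝ)) (𝓝 0) (𝓝 0) := by
    have : Continuous fun x : Space n => (C + C) * (α₂ ‖x‖₊ : ℝ) :=
      continuous_const.mul (NNReal.continuous_coe.comp (hα₂.continuous.comp continuous_nnnorm))
    simpa [hα₂.map_zero] using this.tendsto 0
  obtain ⟨δ, hδ, hδε⟩ := Metric.eventually_nhds_iff.1
    (hcont.eventually_lt_const (hα₁.pos (half_pos hε)))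
  refine ⟨δ, hδ, fun x₀ x hx hx₀ => iSup_enorm_lt_of_norm_lt hε fun t ht => ?_⟩
  obtain ⟨k, hk⟩ := hs.exists_mem_Ico ht
  refine hα₁.norm_lt (half_pos hε).le ?_
  calc (α₁ ‖x t‖₊ : ℝ) ≤ V (s (τ k)) (x t) := (hV1 _ _).1
    _ ≤ _ := hs.le_growth_add_mul hF hV hV0 hL hμ hV3 hx hk
    _ ≤ (C + C) * V (s 0) x₀ :=
      mul_le_mul_of_nonneg_right (add_le_add (hC' _) (hC' _)) (hV0 _ _)
    _ ≤ (C + C) * α₂ ‖x₀‖₊ := by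
      refine mul_le_mul_of_nonneg_left (hV1 _ _).2 ?_
      have := (growth_nonneg (zero_le_one.trans hμ) 0).trans (hC' 0)
      linarith
    _ < _ := hδε (by simpa using hx₀)

/-- Pathwise attractivity of the switched system when the growth factors tend to zero. -/
lemma IsStepPath.attractive (hs : IsStepPath s τ) (hF : ∀ i, Continuous (F i))
    (hV : ∀ i, Differentiable ℝ (V i)) (hα₁ : ClassKInfty α₁) (hα₂ : ClassKInfty α₂)
    (hV1 : ∀ i x, (α₁ ‖x‖₊ : ℝ) ≤ V i x ∧ V i x ≤ (α₂ ‖x‖₊ : ℝ))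
    (hL : ∀ i x, lieDeriv (F i) (V i) x ≤ -lam i * V i x)
    (hμ : 1 ≤ μ) (hV3 : ∀ i j x, V i x ≤ μ * V j x)
    (hg : Tendsto (growth s τ μ lam) atTop (𝓝 0)) (r : ℝ) {ε : ℝ} (hε : 0 < ε) :
    ∃ T : ℝ, 0 ≤ T ∧ ∀ x₀ x, IsSolution F s x₀ x → ‖x₀‖ < r →
      ⨆ t ∈ Set.Ici T, ‖x t‖ₑ < ENNReal.ofReal ε := by
  have hV0 : ∀ i x, 0 ≤ V i x := fun i x => (NNReal.coe_nonneg (α₁ ‖x‖₊)).trans (hV1 i x).1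
  have hlim : Tendsto (fun k => (growth s τ μ lam k + growth s τ μ lam (k + 1)) *
      (α₂ r.toNNReal : ℝ)) atTop (𝓝 0) := by
    simpa using (hg.add (hg.comp (tendsto_add_atTop_nat 1))).mul_const (α₂ r.toNNReal : ℝ)
  -- `K` is fixed by `r` and `ε` alone, which makes the time `τ K` uniform in the initial state.
  obtain ⟨K, hK⟩ := eventually_atTop.1 (hlim.eventually_lt_const (hα₁.pos (half_pos hε)))
  refine ⟨τ K, hs.nonneg K, fun x₀ x hx hx₀ => iSup_enorm_lt_of_norm_lt hε fun t ht => ?_⟩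
  obtain ⟨k, hk⟩ := hs.exists_mem_Ico ((hs.nonneg K).trans ht)
  have hKk : K ≤ k := Nat.lt_succ_iff.1 (hs.strictMono.lt_iff_lt.1 (ht.trans_lt hk.2))
  have hμ0 : 0 ≤ μ := zero_le_one.trans hμ
  refine hα₁.norm_lt (half_pos hε).le ?_
  calc (α₁ ‖x t‖₊ : ℝ) ≤ V (s (τ k)) (x t) := (hV1 _ _).1
    _ ≤ _ := hs.le_growth_add_mul hF hV hV0 hL hμ hV3 hx hk
    _ ≤ (growth s τ μ lam k + growth s τ μ lam (k + 1)) * α₂ r.toNNReal := by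
      refine mul_le_mul_of_nonneg_left ((hV1 _ _).2.trans ?_)
        (add_nonneg (growth_nonneg hμ0 _) (growth_nonneg hμ0 _))
      refine NNReal.coe_le_coe.2 (hα₂.strictMono.monotone ?_)
      exact NNReal.le_toNNReal_of_coe_le hx₀.le
    _ < _ := hK k hKk

end Stability

end RandSwitch

/-! ### The main theorem -/

theorem mainTheorem8 {Ω : Type*} [MeasurableSpace Ω] (P : Measure Ω) [IsProbabilityMeasure P]
    {n m N : ℕ}
    -- the control-affine subsystems
    (f : Fin N → RandSwitch.Space n → RandSwitch.Space n)
    (g : Fin N → Fin m → RandSwitch.Space n → RandSwitch.Space n)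
    (hf : ∀ i, ContDiff ℝ 2 (f i)) (hg : ∀ i j, ContDiff ℝ 2 (g i j))
    (hf0 : ∀ i, f i 0 = 0) (hg0 : ∀ i j, g i j 0 = 0)
    -- the switching signal, of class EH
    (σ : ℝ → Ω → Fin N) (σ₀ : Fin N) (hσ : RandSwitch.IsSwitchingSignal σ σ₀)
    (τ : ℕ → Ω → ℝ) (rate : ℝ) (q : Fin N → ℝ) (hEH : RandSwitch.ClassEH P σ τ rate q)
    -- the Lyapunov functions, with (V1) and (V3)
    (V : Fin N → RandSwitch.Space n → ℝ) (hV : ∀ i, ContDiff ℝ 2 (V i))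
    (α₁ α₂ : ℝ≥0 → ℝ≥0) (hα₁ : RandSwitch.ClassKInfty α₁) (hα₂ : RandSwitch.ClassKInfty α₂)
    (hV1 : ∀ i x, (α₁ ‖x‖₊ : ℝ) ≤ V i x ∧ V i x ≤ (α₂ ‖x‖₊ : ℝ))
    (μ : ℝ) (hμ : 1 < μ) (hV3 : ∀ i j x, V i x ≤ μ * V j x)
    -- the mode-independent feedback
    (k : RandSwitch.Space n → EuclideanSpace ℝ (Fin m))
    (hk : ∀ i, LocallyLipschitz (RandSwitch.closedLoop (f i) (g i) k))
    (lam : Fin N → ℝ)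
    (hV2 : ∀ i x, RandSwitch.lieDeriv (RandSwitch.closedLoop (f i) (g i) k) (V i) x
      ≤ -lam i * V i x)
    -- (E3) and (E4)
    (hE3 : ∀ i, 0 < lam i + rate)
    (hE4 : ∑ i, μ * q i / (1 + lam i / rate) < 1) :
    RandSwitch.WellPosed P (fun i => RandSwitch.closedLoop (f i) (g i) k) σ ∧
      RandSwitch.GASAlmostSurely P (fun i => RandSwitch.closedLoop (f i) (g i) k) σ := by
  have hFc : ∀ i, Continuous (RandSwitch.closedLoop (f i) (g i) k) := fun i => (hk i).continuous
  have hVd : ∀ i, Differentiable ℝ (V i) := fun i => (hV i).differentiable two_ne_zero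
  have hV0 : ∀ i x, 0 ≤ V i x := fun i x => (NNReal.coe_nonneg (α₁ ‖x‖₊)).trans (hV1 i x).1
  have hstep : ∀ᵐ ω ∂P, RandSwitch.IsStepPath (fun t => σ t ω) (fun k => τ k ω) := by
    filter_upwards [hEH.ae_tendsto_instants hσ] with ω hω
    exact ⟨hEH.instants.zero ω, hEH.instants.strictMono ω, hEH.instants.const ω, hω⟩
  have hgrowth : ∀ᵐ ω ∂P, Tendsto (RandSwitch.growth (fun t => σ t ω) (fun k => τ k ω) μ lam)
      atTop (𝓝 0) :=
    hEH.ae_tendsto_prod hσ (zero_le_one.trans hμ.le) hE3 hE4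
  refine ⟨?_, ?_, ?_⟩
  · filter_upwards [hstep] with ω hω
    -- Existence needs a nonnegative growth rate, so `-lam i` is weakened to `|lam i|`.
    refine hω.existsUnique_solution hk fun i a b hab z =>
      RandSwitch.exists_solution_of_lieDeriv_le (hk i) (hVd i) (hV0 i)
        (hα₁.exists_norm_le fun x => (hV1 i x).1) (abs_nonneg (lam i)) (fun x => ?_) hab z
    exact (hV2 i x).trans (mul_le_mul_of_nonneg_right (neg_le_abs _) (hV0 i x))
  · filter_upwards [hstep, hgrowth] with ω hω hg ε hε
    exact hω.stable hFc hVd hα₁ hα₂ hV1 hV2 hμ.le hV3 hg hε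
  · filter_upwards [hstep, hgrowth] with ω hω hg r ε _ hε
    exact hω.attractive hFc hVd hα₁ hα₂ hV1 hV2 hμ.le hV3 hg r hε
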